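/- Let $\mathcal C$ be a non-degenerate elementary topos (finite limits, cartesian closed, subobject classifier $\Omega$, $\emptyset\ne 1$), $PV$ a countable set, and $\Phi$ the formulas $\top,\bot,p\in PV,\neg\varphi,\varphi\wedge\psi,\varphi\vee\psi,\varphi\Rightarrow\psi,\Box\varphi,\Diamond\varphi$. A structuring neighborhood on $X\in\mathcal C$ is a morphism $N:X\to PPX$ such that, in the internal logic, every $N(x)$ is a filter (closed under $\wedge$ and upwards, contains $X$, all members inhabited) and $A\in N(x)\Rightarrow x\in A$; it is topological if moreover $A\in N(x)\Rightarrow\exists B\in N(x)\,\forall y\in B,\ A\in N(y)$. A model is $\mathcal M=(X,N,\nu)$ with $N$ a structuring neighborhood and $\nu:PV\to\mathrm{Sub}(X)$. The interpretation $[\![\mathcal M]\!](\varphi)\in\mathrm{Sub}(X)$ uses the Heyting algebra $\mathrm{Sub}(X)$ for the propositional connectives, the erosion $Y\mapsto\{x\mid Y\in N(x)\}$ for $\Box$ and the dilation $Y\mapsto\{x\mid\forall A\in N(x)\,\exists y\in A\wedge Y\}$ for $\Diamond$. $Mod(\varphi)$ is the class of models with $[\![\mathcal M]\!](\varphi)=Id_X$.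 Two logics are considered: in the basic one all models are allowed; in CS4 only those with $N$ topological. The sequent calculus of each logic consists of the rules of intuitionistic propositional logic, monotonicity of $\Box$ and $\Diamond$, $\Box\top\dashv\vdash\top$, $\Diamond\bot\dashv\vdash\bot$, $\Box\neg\varphi\vdash\neg\Diamond\varphi$, $\Box(\varphi\wedge\psi)\dashv\vdash\Box\varphi\wedge\Box\psi$, $\Diamond\varphi\vee\Diamond\psi\vdash\Diamond(\varphi\vee\psi)$, $\Box(\varphi\Rightarrow\psi)\vdash\Box\varphi\Rightarrow\Box\psi$, $\Box\varphi\vdash\varphi\vdash\Diamond\varphi$, for CS4 also $\Box\varphi\vdash\Box\Box\varphi$ and $\Diamond\Diamond\varphi\vdash\Diamond\varphi$, and $\neg\neg\varphi\vdash\varphi$ if $\mathcal C$ is Boolean. Define $\rho,\kappa:\Phi\to\Phi$ by: $\rho,\kappa$ fix $\top,\bot$ and each $p$; $\rho(\neg\varphi)=\neg\kappa(\varphi)$, $\kappa(\neg\varphi)=\neg\rho(\varphi)$; for $@\in\{\wedge,\vee\}$, $\rho(\varphi\,@\,\psi)=(\rho(\varphi)\,@\,\psi)\vee(\varphi\,@\,\rho(\psi))$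 and $\kappa(\varphi\,@\,\psi)=(\kappa(\varphi)\,@\,\psi)\vee(\varphi\,@\,\kappa(\psi))$; $\rho(\varphi\Rightarrow\psi)=(\kappa(\varphi)\Rightarrow\psi)\vee(\varphi\Rightarrow\rho(\psi))$, $\kappa(\varphi\Rightarrow\psi)=(\varphi\Rightarrow\kappa(\psi))\vee(\rho(\varphi)\Rightarrow\psi)$; $\rho(\Box\varphi)=\Diamond\varphi$, $\kappa(\Box\varphi)=\Box\kappa(\varphi)$; $\rho(\Diamond\varphi)=\Diamond\rho(\varphi)$, $\kappa(\Diamond\varphi)=\Box\varphi$. Given a notion of consistency, a notion $\equiv$ of logical equivalence and a tautology $\chi$ (a formula with $\chi\equiv\top$), let $\tau(\varphi)=\chi$ if $\rho(\varphi)\equiv\varphi$ and $\tau(\varphi)=\rho(\varphi)$ otherwise, and let $\varphi\circ\psi=\tau^n(\varphi)\wedge\psi$ with $n=\min\{k\in\mathbb N\mid\tau^k(\varphi)\wedge\psi\text{ is consistent}\}$ (and $n=0$ if this set is empty). Then, in each of the two logics, $\circ$ satisfies, for all formulas $\varphi,\psi,\psi',\theta$: - (G1) if $\psi$ is consistent,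 then so is $\varphi\circ\psi$; - (G2) $Mod(\varphi\circ\psi)\subseteq Mod(\psi)$; - (G3) if $\varphi\wedge\psi$ is consistent, then $\varphi\circ\psi=\varphi\wedge\psi$; - (G4′) if $\psi\equiv\psi'$, then $Mod(\varphi\circ\psi)=Mod(\varphi\circ\psi')$; - (G5) if $(\varphi\circ\psi)\wedge\theta$ is consistent, then $Mod((\varphi\circ\psi)\wedge\theta)=Mod(\varphi\circ(\psi\wedge\theta))$. This holds both (i) for the proof-theoretic notions, where $\varphi$ is consistent iff $\bot\dashv\vdash\top$ cannot be derived from $\varphi\dashv\vdash\top$, and $\varphi\equiv\psi$ means that $\varphi\dashv\vdash\psi$ is provable, and (ii) for the semantic notions, where $\varphi$ is consistent iff it has a model whose underlying object is not initial, and $\varphi\equiv\psi$ means $Mod(\varphi)=Mod(\psi)$. -/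

import Mathlib

open CategoryTheory MonoidalCategory CartesianMonoidalCategory CategoryTheory.Limits

universe v u w

namespace MorphoLogic

/-! ### Formulas and the transformations `ρ`, `κ`, `τ` -/

/-- Modal formulas over a set `PV` of propositional variables. -/
inductive Formula (PV : Type w) : Type w
  | top : Formula PV
  | bot : Formula PV
  | var : PV → Formula PV
  | neg : Formula PV → Formula PV
  | and : Formula PV → Formula PV → Formula PV
  | or : Formula PV → Formula PV → Formula PV
  | imp : Formula PV → Formula PV → Formula PV
  | box : Formula PV → Formula PV
  | dia : Formula PV → Formula PV

namespace Formula

variable {PV : Type w}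

mutual

/-- The weakening transformation `ρ`. -/
def rho : Formula PV → Formula PV
  | top => top
  | bot => bot
  | var p => var p
  | neg φ => neg (kappa φ)
  | and φ ψ => or (and (rho φ) ψ) (and φ (rho ψ))
  | or φ ψ => or (or (rho φ) ψ) (or φ (rho ψ))
  | imp φ ψ => or (imp (kappa φ) ψ) (imp φ (rho ψ))
  | box φ => dia φ
  | dia φ => dia (rho φ)

/-- The strengthening transformation `κ`. -/
def kappa : Formula PV → Formula PV
  | top => top
  | bot => bot
  | var p => var p
  | neg φ => neg (rho φ)
  | and φ ψ => or (and (kappa φ) ψ) (and φ (kappa ψ))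
  | or φ ψ => or (or (kappa φ) ψ) (or φ (kappa ψ))
  | imp φ ψ => or (imp φ (kappa ψ)) (imp (rho φ) ψ)
  | box φ => box (kappa φ)
  | dia φ => box φ

end

end Formula

section Revision

variable {PV : Type w}

open Classical in
/-- The mapping `τ`, where `eqv` is logical equivalence and `χ` is the chosen tautology:
`τ φ` is `χ` when `ρ φ` is equivalent to `φ`, and `ρ φ` otherwise. -/
noncomputable def tau (eqv : Formula PV → Formula PV → Prop) (χ φ : Formula PV) : Formula PV :=
  if eqv φ.rho φ then χ else φ.rho

/-- The least `k` such that `τᵏ(φ) ∧ ψ` is consistent (and `0` if there is no such `k`). -/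
noncomputable def revisionIndex (cons : Formula PV → Prop)
    (eqv : Formula PV → Formula PV → Prop) (χ φ ψ : Formula PV) : ℕ :=
  sInf {k : ℕ | cons (((tau eqv χ)^[k] φ).and ψ)}

/-- The revision operator `φ ∘ ψ = τⁿ(φ) ∧ ψ`. -/
noncomputable def revise (cons : Formula PV → Prop)
    (eqv : Formula PV → Formula PV → Prop) (χ φ ψ : Formula PV) : Formula PV :=
  ((tau eqv χ)^[revisionIndex cons eqv χ φ ψ] φ).and ψ

/-- The postulates (G1), (G2), (G3), (G4'), (G5) for a revision operator `circ`, relative to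
the assignment `Mod` of classes of models, the notion `cons` of consistency and the notion
`eqv` of logical equivalence. -/
structure SatisfiesAGM {M : Type*} (Mod : Formula PV → Set M) (cons : Formula PV → Prop)
    (eqv : Formula PV → Formula PV → Prop)
    (circ : Formula PV → Formula PV → Formula PV) : Prop where
  G1 : ∀ φ ψ, cons ψ → cons (circ φ ψ)
  G2 : ∀ φ ψ, Mod (circ φ ψ) ⊆ Mod ψ
  G3 : ∀ φ ψ, cons (φ.and ψ) → circ φ ψ = φ.and ψ
  G4' : ∀ φ ψ ψ', eqv ψ ψ' → Mod (circ φ ψ) = Mod (circ φ ψ')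
  G5 : ∀ φ ψ χ, cons ((circ φ ψ).and χ) → Mod ((circ φ ψ).and χ) = Mod (circ φ (ψ.and χ))

end Revision

/-! ### The sequent calculus -/

/-- `Derives s4 cl Γ φ ψ`: the sequent `φ ⊢ ψ` can be obtained from the sequents `γ ⊣⊢ ⊤`,
`γ ∈ Γ`, by the rules of constructive modal logic. The S4 axioms are present when `s4` holds,
the classical axiom when `cl` holds. -/
inductive Derives {PV : Type w} (s4 cl : Prop) (Γ : Set (Formula PV)) :
    Formula PV → Formula PV → Prop
  | hyp {γ} : γ ∈ Γ → Derives s4 cl Γ .top γ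
  | id (φ) : Derives s4 cl Γ φ φ
  | cut {φ ψ χ} : Derives s4 cl Γ φ ψ → Derives s4 cl Γ ψ χ → Derives s4 cl Γ φ χ
  | box_top : Derives s4 cl Γ .top (.box .top)
  | dia_bot : Derives s4 cl Γ (.dia .bot) .bot
  | duality (φ) : Derives s4 cl Γ (.box (.neg φ)) (.neg (.dia φ))
  | box_and (φ ψ) : Derives s4 cl Γ (.box (.and φ ψ)) (.and (.box φ) (.box ψ))
  | and_box (φ ψ) : Derives s4 cl Γ (.and (.box φ) (.box ψ)) (.box (.and φ ψ))
  | or_dia (φ ψ) : Derives s4 cl Γ (.or (.dia φ) (.dia ψ)) (.dia (.or φ ψ))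
  | axK (φ ψ) : Derives s4 cl Γ (.box (.imp φ ψ)) (.imp (.box φ) (.box ψ))
  | box_T (φ) : Derives s4 cl Γ (.box φ) φ
  | dia_T (φ) : Derives s4 cl Γ φ (.dia φ)
  | box_S4 (φ) : s4 → Derives s4 cl Γ (.box φ) (.box (.box φ))
  | dia_S4 (φ) : s4 → Derives s4 cl Γ (.dia (.dia φ)) (.dia φ)
  | classical (φ) : cl → Derives s4 cl Γ (.neg (.neg φ)) φ
  | bot_left (φ) : Derives s4 cl Γ .bot φ
  | top_right (φ) : Derives s4 cl Γ φ .top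
  | and_left (φ ψ) : Derives s4 cl Γ (.and φ ψ) φ
  | and_right (φ ψ) : Derives s4 cl Γ (.and φ ψ) ψ
  | and_idem (φ) : Derives s4 cl Γ φ (.and φ φ)
  | and_comm (φ ψ) : Derives s4 cl Γ (.and φ ψ) (.and ψ φ)
  | and_intro {φ ψ χ} : Derives s4 cl Γ φ ψ → Derives s4 cl Γ φ χ → Derives s4 cl Γ φ (.and ψ χ)
  | or_left (φ ψ) : Derives s4 cl Γ φ (.or φ ψ)
  | or_right (φ ψ) : Derives s4 cl Γ ψ (.or φ ψ)
  | or_comm (φ ψ) : Derives s4 cl Γ (.or φ ψ) (.or ψ φ)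
  | or_elim {φ ψ χ} : Derives s4 cl Γ φ χ → Derives s4 cl Γ ψ χ → Derives s4 cl Γ (.or φ ψ) χ
  | or_inv_left {φ ψ χ} : Derives s4 cl Γ (.or φ ψ) χ → Derives s4 cl Γ φ χ
  | or_inv_right {φ ψ χ} : Derives s4 cl Γ (.or φ ψ) χ → Derives s4 cl Γ ψ χ
  | distrib (φ ψ χ) :
      Derives s4 cl Γ (.and φ (.or ψ χ)) (.or (.and φ ψ) (.and φ χ))
  | distrib_inv (φ ψ χ) :
      Derives s4 cl Γ (.or (.and φ ψ) (.and φ χ)) (.and φ (.or ψ χ))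
  | imp_intro {φ ψ χ} : Derives s4 cl Γ (.and φ ψ) χ → Derives s4 cl Γ φ (.imp ψ χ)
  | imp_elim {φ ψ χ} : Derives s4 cl Γ φ (.imp ψ χ) → Derives s4 cl Γ (.and φ ψ) χ
  | neg_imp (φ) : Derives s4 cl Γ (.neg φ) (.imp φ .bot)
  | imp_neg (φ) : Derives s4 cl Γ (.imp φ .bot) (.neg φ)
  | box_mono {φ ψ} : Derives s4 cl Γ φ ψ → Derives s4 cl Γ (.box φ) (.box ψ)
  | dia_mono {φ ψ} : Derives s4 cl Γ φ ψ → Derives s4 cl Γ (.dia φ) (.dia ψ)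

/-- `φ` is consistent: `⊥ ⊣⊢ ⊤` cannot be obtained from `φ ⊣⊢ ⊤`
(the sequent `⊥ ⊢ ⊤` is an axiom, so only `⊤ ⊢ ⊥` matters). -/
def SynConsistent {PV : Type w} (s4 cl : Prop) (φ : Formula PV) : Prop :=
  ¬ Derives s4 cl {φ} .top .bot

/-- Provable equivalence `φ ⊣⊢ ψ`. -/
def SynEquiv {PV : Type w} (s4 cl : Prop) (φ ψ : Formula PV) : Prop :=
  Derives s4 cl ∅ φ ψ ∧ Derives s4 cl ∅ ψ φ

/-! ### Internal logic of an elementary topos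

A topos is a cartesian closed category with finite limits and a subobject classifier.
A formula in a context `Γ` is a subobject of `Γ`, a term of type `X` in the context `Γ` is a
morphism `Γ ⟶ X`; the context `Γ` extended by a variable of type `X` is `X ⊗ Γ`. -/

noncomputable section Topos

set_option linter.unusedSectionVars false

variable {C : Type u} [Category.{v} C] [CartesianMonoidalCategory C] [MonoidalClosed C]
  [HasFiniteLimits C] [HasSubobjectClassifier C]

/-- Substitution of `f` in a formula. -/
abbrev subst {X Y : C} (f : X ⟶ Y) (A : Subobject Y) : Subobject X :=
  (Subobject.pullback f).obj A

/-- The characteristic morphism of a subobject. -/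
def char {X : C} (A : Subobject X) : X ⟶ HasSubobjectClassifier.Ω C :=
  HasSubobjectClassifier.χ A.arrow

/-- The subobject classified by a morphism to `Ω`. -/
def holds {X : C} (f : X ⟶ HasSubobjectClassifier.Ω C) : Subobject X :=
  subst f (Subobject.mk (HasSubobjectClassifier.truth C))

/-- The power object `PX = Ω ^ X`. -/
abbrev Pow (X : C) : C := (ihom X).obj (HasSubobjectClassifier.Ω C)

/-- The membership relation `∈_X ↣ X × PX`. -/
def memRel (X : C) : Subobject (X ⊗ Pow X) :=
  holds ((ihom.ev X).app (HasSubobjectClassifier.Ω C))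

/-- The formula `t ∈ s`. -/
def mem {Γ X : C} (t : Γ ⟶ X) (s : Γ ⟶ Pow X) : Subobject Γ := subst (lift t s) (memRel X)

/-- The term `{x : X | A}`. -/
def compr {Γ X : C} (A : Subobject (X ⊗ Γ)) : Γ ⟶ Pow X := MonoidalClosed.curry (char A)

/-- Implication: the largest subobject on which `A ∧ B` and `A` agree. -/
def impl {Γ : C} (A B : Subobject Γ) : Subobject Γ := equalizerSubobject (char (A ⊓ B)) (char A)

/-- Universal quantification over `x : X`: the largest subobject on which `{x : X | A}` is
all of `X`. -/
def all {Γ : C} (X : C) (A : Subobject (X ⊗ Γ)) : Subobject Γ :=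
  equalizerSubobject (compr A) (compr ⊤)

/-- The variable `w : Ω`, as a formula. -/
def omegaVar (Γ : C) : Subobject (HasSubobjectClassifier.Ω C ⊗ Γ) := holds (fst _ _)

/-- Falsity, `∀ w : Ω, w`. It is the least subobject. -/
def fals (Γ : C) : Subobject Γ := all _ (omegaVar Γ)

/-- Disjunction, `∀ w : Ω, (A ⇒ w) ∧ (B ⇒ w) ⇒ w`. It is the supremum of `A` and `B`. -/
def disj {Γ : C} (A B : Subobject Γ) : Subobject Γ :=
  all _ (impl (impl (subst (snd _ _) A) (omegaVar Γ) ⊓ impl (subst (snd _ _) B) (omegaVar Γ))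
    (omegaVar Γ))

/-- Existential quantification over `x : X`, `∀ w : Ω, (∀ x : X, A ⇒ w) ⇒ w`. It is the image
of `A` under the projection `X × Γ ⟶ Γ`. -/
def ex {Γ : C} (X : C) (A : Subobject (X ⊗ Γ)) : Subobject Γ :=
  all _ (impl (all X (impl (subst (X ◁ snd _ _) A) (subst (snd _ _) (omegaVar Γ)))) (omegaVar Γ))

theorem holds_char {X : C} (A : Subobject X) : holds (char A) = A := by
  have := Subobject.Classifier.pullback_χ_obj_mk_truth
    (HasSubobjectClassifier.exists_classifier (C := C)).some A.arrow
  rw [Subobject.mk_arrow] at this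
  exact this

theorem char_holds {X : C} (f : X ⟶ HasSubobjectClassifier.Ω C) : char (holds f) = f :=
  Subobject.Classifier.χ_pullback_obj_mk_truth_arrow _ f

theorem subst_holds {X Y : C} (f : X ⟶ Y) (g : Y ⟶ HasSubobjectClassifier.Ω C) :
    subst f (holds g) = holds (f ≫ g) := (Subobject.pullback_comp f g _).symm

theorem char_subst {X Y : C} (f : X ⟶ Y) (A : Subobject Y) : char (subst f A) = f ≫ char A := by
  rw [← char_holds (f ≫ char A), ← subst_holds, holds_char]

theorem subst_mono {X Y : C} (f : X ⟶ Y) {A B : Subobject Y} (h : A ≤ B) :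
    subst f A ≤ subst f B := (Subobject.pullback f).monotone h

theorem factors_iff {X Y : C} (P : Subobject Y) (g : X ⟶ Y) : P.Factors g ↔ subst g P = ⊤ := by
  constructor
  · intro h
    have hp := Subobject.isPullback g P
    have h2 := Subobject.factors_comp_arrow (P := subst g P)
      (hp.lift (P.factorThru g h) (𝟙 _) (by simp))
    rw [hp.lift_snd] at h2
    rw [eq_top_iff]
    refine Subobject.le_of_factors ?_
    rw [← Category.comp_id (Subobject.arrow ⊤)]
    exact Subobject.factors_of_factors_right _ h2
  · intro h
    have w := (Subobject.isPullback g P).w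
    have hi : IsIso ((Subobject.pullback g).obj P).arrow :=
      (Subobject.isIso_arrow_iff_eq_top _).2 h
    have : g = (inv ((Subobject.pullback g).obj P).arrow ≫ Subobject.pullbackπ g P) ≫ P.arrow := by
      rw [Category.assoc, w, IsIso.inv_hom_id_assoc]
    rw [this]
    exact Subobject.factors_comp_arrow _

theorem subst_comp {X Y Z : C} (f : X ⟶ Y) (g : Y ⟶ Z) (A : Subobject Z) :
    subst (f ≫ g) A = subst f (subst g A) := Subobject.pullback_comp f g A

theorem subst_id {X : C} (A : Subobject X) : subst (𝟙 X) A = A := Subobject.pullback_id A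

theorem subst_top {X Y : C} (f : X ⟶ Y) : subst f (⊤ : Subobject Y) = ⊤ :=
  Subobject.pullback_top f

theorem subst_inf {X Y : C} (f : X ⟶ Y) (A B : Subobject Y) :
    subst f (A ⊓ B) = subst f A ⊓ subst f B := Subobject.inf_pullback f A B

/-- Inclusion of subobjects, tested on generalized elements. -/
theorem le_iff {X : C} (U P : Subobject X) :
    U ≤ P ↔ ∀ {T : C} (g : T ⟶ X), subst g U = ⊤ → subst g P = ⊤ := by
  constructor
  · intro h T g hg
    exact top_le_iff.1 (hg ▸ subst_mono g h)
  · intro h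
    refine Subobject.le_of_factors ((factors_iff _ _).2 (h _ ?_))
    exact (factors_iff _ _).1 (Subobject.factors_self U)

theorem subst_impl_eq_top {Δ Γ : C} (g : Δ ⟶ Γ) (A B : Subobject Γ) :
    subst g (impl A B) = ⊤ ↔ subst g A ≤ subst g B := by
  rw [← factors_iff, impl, equalizerSubobject_factors_iff, ← char_subst, ← char_subst,
    ← inf_eq_left, subst_inf]
  exact ⟨fun h => by rw [← holds_char (_ ⊓ _), h, holds_char], fun h => by rw [h]⟩

theorem subst_all_eq_top {Δ Γ : C} (X : C) (g : Δ ⟶ Γ) (A : Subobject (X ⊗ Γ)) :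
    subst g (all X A) = ⊤ ↔ subst (X ◁ g) A = ⊤ := by
  rw [← factors_iff, all, equalizerSubobject_factors_iff, compr, compr,
    ← MonoidalClosed.curry_natural_left, ← MonoidalClosed.curry_natural_left, ← char_subst,
    ← char_subst, MonoidalClosed.curry_injective.eq_iff, subst_top]
  exact ⟨fun h => by rw [← holds_char (subst (X ◁ g) A), h, holds_char], fun h => by rw [h]⟩

theorem subst_impl {Δ Γ : C} (g : Δ ⟶ Γ) (A B : Subobject Γ) :
    subst g (impl A B) = impl (subst g A) (subst g B) := by
  apply le_antisymm <;> rw [le_iff] <;> intro T h hh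
  · rw [subst_impl_eq_top, ← subst_comp, ← subst_comp]
    rwa [← subst_comp, subst_impl_eq_top] at hh
  · rw [← subst_comp, subst_impl_eq_top]
    rwa [subst_impl_eq_top, ← subst_comp, ← subst_comp] at hh

theorem subst_all {Δ Γ : C} (X : C) (g : Δ ⟶ Γ) (A : Subobject (X ⊗ Γ)) :
    subst g (all X A) = all X (subst (X ◁ g) A) := by
  apply le_antisymm <;> rw [le_iff] <;> intro T h hh
  · rw [subst_all_eq_top, ← subst_comp, ← whiskerLeft_comp]
    rwa [← subst_comp, subst_all_eq_top] at hh
  · rw [← subst_comp, subst_all_eq_top, whiskerLeft_comp, subst_comp]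
    rwa [subst_all_eq_top] at hh

/-- Implication is right adjoint to the meet. -/
theorem le_impl_iff {Γ : C} (U A B : Subobject Γ) : U ≤ impl A B ↔ U ⊓ A ≤ B := by
  constructor
  · intro h
    rw [le_iff]
    intro T g hg
    rw [subst_inf, inf_eq_top_iff] at hg
    have h1 := (subst_impl_eq_top g A B).1 ((le_iff _ _).1 h g hg.1)
    rwa [hg.2, top_le_iff] at h1
  · intro h
    rw [le_iff]
    intro T g hg
    rw [subst_impl_eq_top]
    have := subst_mono g h
    rwa [subst_inf, hg, top_inf_eq] at this

/-- Universal quantification is right adjoint to substitution along the projection. -/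
theorem le_all_iff {Γ : C} (X : C) (U : Subobject Γ) (A : Subobject (X ⊗ Γ)) :
    U ≤ all X A ↔ subst (snd X Γ) U ≤ A := by
  constructor
  · intro h
    rw [le_iff]
    intro T g hg
    rw [← subst_comp] at hg
    have h1 := (subst_all_eq_top X _ A).1 ((le_iff _ _).1 h _ hg)
    have h2 : g = lift (g ≫ fst X Γ) (𝟙 T) ≫ X ◁ (g ≫ snd X Γ) := by
      ext <;> simp
    rw [h2, subst_comp, h1, subst_top]
  · intro h
    rw [le_iff]
    intro T g hg
    rw [subst_all_eq_top, ← top_le_iff]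
    have h1 := subst_mono (X ◁ g) h
    rwa [← subst_comp, whiskerLeft_snd, subst_comp, hg, subst_top] at h1

/-- Instantiation of a universally quantified formula. -/
theorem all_le_subst {Γ X : C} (t : Γ ⟶ X) (A : Subobject (X ⊗ Γ)) :
    all X A ≤ subst (lift t (𝟙 Γ)) A := by
  have h := subst_mono (lift t (𝟙 Γ)) ((le_all_iff X _ A).1 le_rfl)
  rwa [← subst_comp, lift_snd, subst_id] at h

theorem subst_omegaVar {Γ : C} (B : Subobject Γ) :
    subst (lift (char B) (𝟙 Γ)) (omegaVar Γ) = B := by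
  rw [omegaVar, subst_holds, lift_fst, holds_char]

theorem fals_le {Γ : C} (B : Subobject Γ) : fals Γ ≤ B := by
  have h := all_le_subst (char B) (omegaVar Γ)
  rwa [subst_omegaVar] at h

theorem disj_le_iff {Γ : C} (A B D : Subobject Γ) : disj A B ≤ D ↔ A ≤ D ∧ B ≤ D := by
  constructor
  · refine fun h => ⟨le_trans ?_ h, le_trans ?_ h⟩ <;>
      rw [disj, le_all_iff, le_impl_iff, inf_comm, ← le_impl_iff]
    · refine le_trans inf_le_left ?_
      rw [le_impl_iff, ← le_impl_iff]
    · refine le_trans inf_le_right ?_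
      rw [le_impl_iff, ← le_impl_iff]
  · rintro ⟨hA, hB⟩
    have h := all_le_subst (char D)
      (impl (impl (subst (snd _ _) A) (omegaVar Γ) ⊓ impl (subst (snd _ _) B) (omegaVar Γ))
        (omegaVar Γ))
    simp only [subst_impl, subst_inf, subst_omegaVar, ← subst_comp, lift_snd, subst_id] at h
    rw [(top_le_iff.1 ((le_impl_iff ⊤ A D).2 (by simpa using hA)) : impl A D = ⊤),
      (top_le_iff.1 ((le_impl_iff ⊤ B D).2 (by simpa using hB)) : impl B D = ⊤), le_impl_iff] at h
    simpa [disj] using h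

/-- Existential quantification is left adjoint to substitution along the projection. -/
theorem ex_le_iff {Γ : C} (X : C) (A : Subobject (X ⊗ Γ)) (D : Subobject Γ) :
    ex X A ≤ D ↔ A ≤ subst (snd X Γ) D := by
  constructor
  · intro h
    refine le_trans ?_ (subst_mono (snd X Γ) h)
    rw [le_iff]
    intro T g hg
    rw [← subst_comp, ex, subst_all_eq_top, subst_impl_eq_top, subst_all]
    refine le_trans (all_le_subst (snd _ T ≫ g ≫ fst X Γ) _) ?_
    simp only [subst_impl, ← subst_comp]
    have e : lift (snd (HasSubobjectClassifier.Ω C) T ≫ g ≫ fst X Γ) (𝟙 _) ≫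
        X ◁ HasSubobjectClassifier.Ω C ◁ (g ≫ snd X Γ) ≫
        X ◁ snd (HasSubobjectClassifier.Ω C) Γ = snd _ _ ≫ g := by
      ext <;> simp
    rw [e, subst_comp (snd _ _) g, hg, subst_top, whiskerLeft_snd,
      lift_snd_assoc, Category.id_comp]
    refine le_trans (le_inf le_rfl le_top) ((le_impl_iff _ _ _).1 le_rfl)
  · intro h
    have h1 := all_le_subst (char D)
      (impl (all X (impl (subst (X ◁ snd _ _) A) (subst (snd _ _) (omegaVar Γ)))) (omegaVar Γ))
    simp only [subst_impl, subst_omegaVar, subst_all, ← subst_comp, lift_snd, subst_id,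
      ← whiskerLeft_comp, whiskerLeft_id, whiskerLeft_snd,
      subst_comp (snd X Γ)] at h1
    have h2 : all X (impl A (subst (snd X Γ) D)) = ⊤ := by
      rw [← top_le_iff, le_all_iff, le_impl_iff]
      exact le_trans inf_le_right h
    rw [h2, le_impl_iff, inf_top_eq] at h1
    exact h1

/-- The Heyting algebra of subobjects. -/
instance heyting (Γ : C) : HeytingAlgebra (Subobject Γ) where
  sup := disj
  le_sup_left A B := ((disj_le_iff A B _).1 le_rfl).1
  le_sup_right A B := ((disj_le_iff A B _).1 le_rfl).2
  sup_le _ _ _ h h' := (disj_le_iff _ _ _).2 ⟨h, h'⟩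
  inf := (· ⊓ ·)
  inf_le_left _ _ := inf_le_left
  inf_le_right _ _ := inf_le_right
  le_inf _ _ _ := le_inf
  top := ⊤
  le_top _ := le_top
  himp := impl
  le_himp_iff := le_impl_iff
  bot := fals Γ
  bot_le := fals_le
  compl A := impl A (fals Γ)
  himp_bot _ := rfl

/-- The term `s ∧ t` of type `PX`. -/
def inter {Γ X : C} (s t : Γ ⟶ Pow X) : Γ ⟶ Pow X :=
  compr (mem (fst X Γ) (snd X Γ ≫ s) ⊓ mem (fst X Γ) (snd X Γ ≫ t))

/-- The formula `s ⪯ t`, for terms of type `PX`: it states `s ∧ t = s`. -/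
def incl {Γ X : C} (s t : Γ ⟶ Pow X) : Subobject Γ := equalizerSubobject (inter s t) s

/-! ### Structuring neighborhoods, erosion and dilation -/

/-- The formula `𝓕(F)`: the term `F : PPX` is a filter. In the first two conjuncts the context
is `B : PX, A : PX`, in the last one it is `A : PX`, then `x : X, A : PX`. -/
def filterFormula {Γ X : C} (F : Γ ⟶ Pow (Pow X)) : Subobject Γ :=
  all (Pow X) (all (Pow X)
    (mem (snd _ _ ≫ fst _ _) (snd _ _ ≫ snd _ _ ≫ F) ⊓ mem (fst _ _) (snd _ _ ≫ snd _ _ ≫ F) ⇨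
      mem (inter (snd _ _ ≫ fst _ _) (fst _ _)) (snd _ _ ≫ snd _ _ ≫ F))) ⊓
  all (Pow X) (all (Pow X)
    (mem (snd _ _ ≫ fst _ _) (snd _ _ ≫ snd _ _ ≫ F) ⊓ incl (snd _ _ ≫ fst _ _) (fst _ _) ⇨
      mem (fst _ _) (snd _ _ ≫ snd _ _ ≫ F))) ⊓
  mem (compr ⊤) F ⊓
  all (Pow X) (mem (fst _ _) (snd _ _ ≫ F) ⇨ ex X (mem (fst _ _) (snd _ _ ≫ fst _ _)))

/-- Structuring neighborhoods: `N(x)` is a filter, and `A ∈ N(x) ⇒ x ∈ A`. -/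
structure IsStructuringNeighborhood {X : C} (N : X ⟶ Pow (Pow X)) : Prop where
  filter : filterFormula N = ⊤
  point : all (Pow X) (mem (fst _ _) (snd _ _ ≫ N) ⇨ mem (snd _ _) (fst (Pow X) X)) = ⊤

/-- Topological neighborhoods: moreover
`A ∈ N(x) ⇒ ∃ B, B ∈ N(x) ∧ ∀ y, y ∈ B ⇒ A ∈ N(y)`. -/
structure IsTopologicalNeighborhood {X : C} (N : X ⟶ Pow (Pow X)) : Prop
    extends IsStructuringNeighborhood N where
  topological : all (Pow X) (mem (fst _ _) (snd _ _ ≫ N) ⇨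
    ex (Pow X) (mem (fst _ _) (snd _ _ ≫ snd _ _ ≫ N) ⊓
      all X (mem (fst _ _) (snd _ _ ≫ fst _ _) ⇨
        mem (snd _ _ ≫ snd _ _ ≫ fst _ _) (fst X (Pow X ⊗ (Pow X ⊗ X)) ≫ N)))) = ⊤

/-- The erosion `Y ↦ {x : X | Y ∈ N(x)}`. -/
def erosion {X : C} (N : X ⟶ Pow (Pow X)) : Pow X ⟶ Pow X :=
  compr (mem (snd _ _) (fst X (Pow X) ≫ N))

/-- The dilation `Y ↦ {x : X | ∀ A, A ∈ N(x) ⇒ ∃ y, y ∈ A ∧ Y}`. -/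
def dilation {X : C} (N : X ⟶ Pow (Pow X)) : Pow X ⟶ Pow X :=
  compr (all (Pow X) (mem (fst _ _) (snd _ _ ≫ fst X (Pow X) ≫ N) ⇨
    ex X (mem (fst _ _) (snd _ _ ≫ inter (fst _ _) (snd _ _ ≫ snd X (Pow X))))))

/-- The bijection `Sub(X) ≃ Hom(1, PX)`, from left to right. -/
def toGlobal {X : C} (A : Subobject X) : 𝟙_ C ⟶ Pow X := compr (subst (fst X (𝟙_ C)) A)

/-- The bijection `Sub(X) ≃ Hom(1, PX)`, from right to left. -/
def ofGlobal {X : C} (s : 𝟙_ C ⟶ Pow X) : Subobject X := mem (𝟙 X) (toUnit X ≫ s)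

/-- The operation on `Sub(X)` induced by a morphism `PX ⟶ PX`. -/
def onSub {X : C} (f : Pow X ⟶ Pow X) (A : Subobject X) : Subobject X :=
  ofGlobal (toGlobal A ≫ f)

/-! ### Models and satisfaction -/

variable (C) in
/-- The topos is Boolean. -/
def IsBoolean : Prop := ∀ (X : C) (A : Subobject X), A ⊔ (A ⇨ ⊥) = ⊤

variable (C) in
/-- Models `(X, N, ν)` in the topos `C`; when `s4` holds, `N` is a topological neighborhood. -/
structure Model (PV : Type w) (s4 : Prop) where
  X : C
  N : X ⟶ Pow (Pow X)
  structuring : IsStructuringNeighborhood N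
  topological : s4 → IsTopologicalNeighborhood N
  val : PV → Subobject X

namespace Model

variable {PV : Type w} {s4 : Prop}

/-- The interpretation of a formula in a model. -/
def sem (M : Model C PV s4) : Formula PV → Subobject M.X
  | .top => ⊤
  | .bot => ⊥
  | .var p => M.val p
  | .neg φ => M.sem φ ⇨ ⊥
  | .and φ ψ => M.sem φ ⊓ M.sem ψ
  | .or φ ψ => M.sem φ ⊔ M.sem ψ
  | .imp φ ψ => M.sem φ ⇨ M.sem ψ
  | .box φ => onSub (erosion M.N) (M.sem φ)
  | .dia φ => onSub (dilation M.N) (M.sem φ)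

/-- `M ⊨ φ`. -/
def Sat (M : Model C PV s4) (φ : Formula PV) : Prop := M.sem φ = ⊤

end Model

variable (C) in
/-- The class of models of `φ`. -/
def Mod {PV : Type w} (s4 : Prop) (φ : Formula PV) : Set (Model C PV s4) := {M | M.Sat φ}

variable (C) in
/-- Semantic consistency: `φ` has a model that does not satisfy `⊥`, i.e. a model on an object
that is not initial. -/
def SemConsistent {PV : Type w} (s4 : Prop) (φ : Formula PV) : Prop :=
  ∃ M ∈ Mod C s4 φ, M ∉ Mod C s4 (.bot : Formula PV)

variable (C) in
/-- Semantic equivalence: `φ` and `ψ` have the same models. -/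
def SemEquiv {PV : Type w} (s4 : Prop) (φ ψ : Formula PV) : Prop := Mod C s4 φ = Mod C s4 ψ

end Topos

end MorphoLogic

-- (G2), (G3), (G4') and (G5) only use that conjunction is a meet for an entailment relation along
-- which consistency and `Mod` are monotone. For (G1) one must know that the minimum defining the
-- revision is attained, and for this it suffices that some iterate `τ^k(φ)` is `χ`: then `χ ∧ ψ` is
-- as consistent as `ψ`. By the definition of `τ` this happens as soon as some iterate of `ρ` at `φ`
-- is a fixed point of `ρ` up to equivalence (`exists_tau_iterate_eq`).
--
-- The heart of the matter is therefore `Formula.exists_iterate_bounds`: up to provable entailment,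
-- the `ρ`-iterates of a formula have a weakest member and the `κ`-iterates a strongest one. Both
-- claims are proved in one induction, since negation and implication exchange `ρ` and `κ`.
-- Iterating `ρ` on a binary connective yields a nested disjunction whose leaves combine iterates of
-- the two components, so the combination of the extremal component iterates bounds it, and that
-- bound is reached after the sum of the two indices. Iterating `κ` on a disjunction changes nothing
-- up to equivalence, so for `∧` and `⇒` the process stalls after one step.
--
-- Soundness of the calculus in the internal logic (`Model.sem_le_of_derives`) makes `Mod` monotone
-- along derivability and transfers the stabilization to semantic equivalence. The postulates then
-- follow for both notions from `satisfiesAGM_of_entailment`.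

namespace MorphoLogic

-- Derived rules of the sequent calculus

section Calculus

variable {PV : Type w} {s4 cl : Prop} {Γ : Set (Formula PV)}

namespace Derives

theorem and_mono {φ φ' ψ ψ' : Formula PV} (h : Derives s4 cl Γ φ φ') (h' : Derives s4 cl Γ ψ ψ') :
    Derives s4 cl Γ (φ.and ψ) (φ'.and ψ') :=
  and_intro (cut (and_left _ _) h) (cut (and_right _ _) h')

theorem or_mono {φ φ' ψ ψ' : Formula PV} (h : Derives s4 cl Γ φ φ') (h' : Derives s4 cl Γ ψ ψ') :
    Derives s4 cl Γ (φ.or ψ) (φ'.or ψ') :=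
  or_elim (cut h (or_left _ _)) (cut h' (or_right _ _))

theorem imp_mono {φ φ' ψ ψ' : Formula PV} (h : Derives s4 cl Γ φ' φ) (h' : Derives s4 cl Γ ψ ψ') :
    Derives s4 cl Γ (φ.imp ψ) (φ'.imp ψ') :=
  imp_intro (cut (and_mono (id _) h) (cut (imp_elim (id _)) h'))

theorem neg_anti {φ ψ : Formula PV} (h : Derives s4 cl Γ φ ψ) : Derives s4 cl Γ ψ.neg φ.neg :=
  cut (neg_imp _) (cut (imp_mono h (id _)) (imp_neg _))

/-- Derivations may be composed with derivations of their hypotheses. -/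
theorem of_derives_hyps {Δ : Set (Formula PV)} (h : ∀ γ ∈ Γ, Derives s4 cl Δ .top γ)
    {α β : Formula PV} (d : Derives s4 cl Γ α β) : Derives s4 cl Δ α β := by
  induction d with
  | hyp hγ => exact h _ hγ
  | id φ => exact .id φ
  | cut _ _ h1 h2 => exact .cut h1 h2
  | box_top => exact .box_top
  | dia_bot => exact .dia_bot
  | duality φ => exact .duality φ
  | box_and φ ψ => exact .box_and φ ψ
  | and_box φ ψ => exact .and_box φ ψ
  | or_dia φ ψ => exact .or_dia φ ψ
  | axK φ ψ => exact .axK φ ψ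
  | box_T φ => exact .box_T φ
  | dia_T φ => exact .dia_T φ
  | box_S4 φ h1 => exact .box_S4 φ h1
  | dia_S4 φ h1 => exact .dia_S4 φ h1
  | classical φ h1 => exact .classical φ h1
  | bot_left φ => exact .bot_left φ
  | top_right φ => exact .top_right φ
  | and_left φ ψ => exact .and_left φ ψ
  | and_right φ ψ => exact .and_right φ ψ
  | and_idem φ => exact .and_idem φ
  | and_comm φ ψ => exact .and_comm φ ψ
  | and_intro _ _ h1 h2 => exact .and_intro h1 h2
  | or_left φ ψ => exact .or_left φ ψ
  | or_right φ ψ => exact .or_right φ ψ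
  | or_comm φ ψ => exact .or_comm φ ψ
  | or_elim _ _ h1 h2 => exact .or_elim h1 h2
  | or_inv_left _ h1 => exact .or_inv_left h1
  | or_inv_right _ h1 => exact .or_inv_right h1
  | distrib φ ψ θ => exact .distrib φ ψ θ
  | distrib_inv φ ψ θ => exact .distrib_inv φ ψ θ
  | imp_intro _ h1 => exact .imp_intro h1
  | imp_elim _ h1 => exact .imp_elim h1
  | neg_imp φ => exact .neg_imp φ
  | imp_neg φ => exact .imp_neg φ
  | box_mono _ h1 => exact .box_mono h1
  | dia_mono _ h1 => exact .dia_mono h1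

end Derives

open Derives

/-- From the hypothesis `⊤ ⊢ φ` a cut gives `⊤ ⊢ ψ`, so a refutation of `ψ` becomes a refutation of
`φ`. -/
theorem SynConsistent.mono {φ ψ : Formula PV} (h : Derives s4 cl ∅ φ ψ)
    (hφ : SynConsistent s4 cl φ) : SynConsistent s4 cl ψ :=
  fun d => hφ (of_derives_hyps (fun _ hγ => Set.mem_singleton_iff.1 hγ ▸ cut (hyp rfl)
    (of_derives_hyps (fun _ h' => absurd h' (Set.notMem_empty _)) h)) d)

/-! ### Stabilization of the iterates of `ρ` and `κ` -/

namespace Formula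

/-- The two halves need each other: `¬` and `⇒` are antitone on the left and exchange `ρ` with `κ`.
For the binary connectives, weakening needs just one disjunct of `ρ`, whereas strengthening has to
treat both disjuncts of `κ`. -/
theorem derives_rho_and_kappa_derives (φ : Formula PV) :
    Derives s4 cl Γ φ φ.rho ∧ Derives s4 cl Γ φ.kappa φ := by
  induction φ with
  | top | bot | var => exact ⟨.id _, .id _⟩
  | neg φ ih => exact ⟨neg_anti ih.2, neg_anti ih.1⟩
  | and φ ψ ihφ ihψ =>
    exact ⟨cut (and_mono ihφ.1 (.id _)) (or_left _ _),
      or_elim (and_mono ihφ.2 (.id _)) (and_mono (.id _) ihψ.2)⟩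
  | or φ ψ ihφ ihψ =>
    exact ⟨cut (or_mono ihφ.1 (.id _)) (or_left _ _),
      or_elim (or_mono ihφ.2 (.id _)) (or_mono (.id _) ihψ.2)⟩
  | imp φ ψ ihφ ihψ =>
    exact ⟨cut (imp_mono ihφ.2 (.id _)) (or_left _ _),
      or_elim (imp_mono (.id _) ihψ.2) (imp_mono ihφ.1 (.id _))⟩
  | box φ ih => exact ⟨cut (box_T _) (dia_T _), box_mono ih.2⟩
  | dia φ ih => exact ⟨dia_mono ih.1, cut (box_T _) (dia_T _)⟩

theorem iterate_rho_neg (n : ℕ) (φ : Formula PV) : rho^[n] φ.neg = (kappa^[n] φ).neg := by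
  induction n generalizing φ with
  | zero => rfl
  | succ n ih => exact ih φ.kappa

theorem iterate_kappa_neg (n : ℕ) (φ : Formula PV) : kappa^[n] φ.neg = (rho^[n] φ).neg := by
  induction n generalizing φ with
  | zero => rfl
  | succ n ih => exact ih φ.rho

theorem iterate_rho_dia (n : ℕ) (φ : Formula PV) : rho^[n] φ.dia = (rho^[n] φ).dia := by
  induction n generalizing φ with
  | zero => rfl
  | succ n ih => exact ih φ.rho

theorem iterate_kappa_box (n : ℕ) (φ : Formula PV) : kappa^[n] φ.box = (kappa^[n] φ).box := by
  induction n generalizing φ with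
  | zero => rfl
  | succ n ih => exact ih φ.kappa

/-- `ρ` of a disjunction is again a disjunction, so one can choose at every step the disjunct in
which the component of interest has advanced. -/
theorem derives_iterate_rho_or (n : ℕ) (φ ψ : Formula PV) :
    Derives s4 cl Γ (rho^[n] φ) (rho^[n] (φ.or ψ)) ∧
      Derives s4 cl Γ (rho^[n] ψ) (rho^[n] (φ.or ψ)) := by
  induction n generalizing φ ψ with
  | zero => exact ⟨or_left _ _, or_right _ _⟩
  | succ n ih => exact ⟨cut (ih φ.rho ψ).1 (ih _ _).1, cut (ih φ ψ.rho).2 (ih _ _).2⟩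

/-- The `n`-th iterate unfolds to nested disjunctions with leaves `ρ^i φ` and `ρ^i ψ`, `i ≤ n`.
Induction is strong because the two disjuncts of `ρ (φ ∨ ψ)` are themselves disjunctions, needed at
all exponents up to `n`. -/
theorem iterate_rho_or_derives {θ : Formula PV} (n : ℕ) (φ ψ : Formula PV)
    (hφ : ∀ i ≤ n, Derives s4 cl Γ (rho^[i] φ) θ) (hψ : ∀ i ≤ n, Derives s4 cl Γ (rho^[i] ψ) θ) :
    Derives s4 cl Γ (rho^[n] (φ.or ψ)) θ := by
  induction n using Nat.strong_induction_on generalizing φ ψ with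
  | _ n ih =>
    cases n with
    | zero => exact or_elim (hφ 0 le_rfl) (hψ 0 le_rfl)
    | succ n =>
      refine ih n n.lt_succ_self _ _ (fun i hi => ?_) (fun i hi => ?_)
      · exact ih i (by omega) _ _ (fun j hj => hφ (j + 1) (by omega))
          (fun j hj => hψ j (by omega))
      · exact ih i (by omega) _ _ (fun j hj => hφ j (by omega))
          (fun j hj => hψ (j + 1) (by omega))

/-- Each application of `ρ` advances one conjunct in each disjunct: select the left disjunct `i`
times, then the right one `j` times. -/
theorem derives_iterate_rho_and (i j : ℕ) (φ ψ : Formula PV) :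
    Derives s4 cl Γ ((rho^[i] φ).and (rho^[j] ψ)) (rho^[i + j] (φ.and ψ)) := by
  induction i generalizing φ ψ with
  | zero =>
    rw [Nat.zero_add]
    induction j generalizing ψ with
    | zero => exact .id _
    | succ j ih => exact cut (ih ψ.rho) (derives_iterate_rho_or _ _ _).2
  | succ i ih =>
    rw [Nat.succ_add]
    exact cut (ih φ.rho ψ) (derives_iterate_rho_or _ _ _).1

theorem iterate_rho_and_derives {α β : Formula PV} (n : ℕ) (φ ψ : Formula PV)
    (hφ : ∀ i, Derives s4 cl Γ (rho^[i] φ) α) (hψ : ∀ i, Derives s4 cl Γ (rho^[i] ψ) β) :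
    Derives s4 cl Γ (rho^[n] (φ.and ψ)) (α.and β) := by
  induction n using Nat.strong_induction_on generalizing φ ψ with
  | _ n ih =>
    cases n with
    | zero => exact and_mono (hφ 0) (hψ 0)
    | succ n =>
      refine iterate_rho_or_derives n _ _ (fun i hi => ?_) (fun i hi => ?_)
      · exact ih i (by omega) _ _ (fun j => hφ (j + 1)) hψ
      · exact ih i (by omega) _ _ hφ (fun j => hψ (j + 1))

theorem derives_iterate_rho_imp (i j : ℕ) (φ ψ : Formula PV) :
    Derives s4 cl Γ ((kappa^[i] φ).imp (rho^[j] ψ)) (rho^[i + j] (φ.imp ψ)) := by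
  induction i generalizing φ ψ with
  | zero =>
    rw [Nat.zero_add]
    induction j generalizing ψ with
    | zero => exact .id _
    | succ j ih => exact cut (ih ψ.rho) (derives_iterate_rho_or _ _ _).2
  | succ i ih =>
    rw [Nat.succ_add]
    exact cut (ih φ.kappa ψ) (derives_iterate_rho_or _ _ _).1

theorem iterate_rho_imp_derives {α β : Formula PV} (n : ℕ) (φ ψ : Formula PV)
    (hφ : ∀ i, Derives s4 cl Γ α (kappa^[i] φ)) (hψ : ∀ i, Derives s4 cl Γ (rho^[i] ψ) β) :
    Derives s4 cl Γ (rho^[n] (φ.imp ψ)) (α.imp β) := by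
  induction n using Nat.strong_induction_on generalizing φ ψ with
  | _ n ih =>
    cases n with
    | zero => exact imp_mono (hφ 0) (hψ 0)
    | succ n =>
      refine iterate_rho_or_derives n _ _ (fun i hi => ?_) (fun i hi => ?_)
      · exact ih i (by omega) _ _ (fun j => hφ (j + 1)) hψ
      · exact ih i (by omega) _ _ hφ (fun j => hψ (j + 1))

/-- In `(κφ ∨ ψ) ∨ (φ ∨ κψ)` both `φ` and `ψ` survive as disjuncts, so `κ` does not really
strengthen a disjunction. -/
theorem derives_iterate_kappa_or (n : ℕ) (φ ψ : Formula PV) :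
    Derives s4 cl Γ (φ.or ψ) (kappa^[n] (φ.or ψ)) := by
  induction n generalizing φ ψ with
  | zero => exact .id _
  | succ n ih =>
    exact cut (or_elim (cut (or_left φ ψ.kappa) (or_right _ _))
      (cut (or_right φ.kappa ψ) (or_left _ _))) (ih _ _)

theorem kappa_derives_iterate_kappa {φ α β : Formula PV} (h : φ.kappa = α.or β) (n : ℕ) :
    Derives s4 cl Γ (kappa^[1] φ) (kappa^[n] φ) := by
  cases n with
  | zero => exact (derives_rho_and_kappa_derives φ).2
  | succ n =>
    rw [Function.iterate_one, Function.iterate_succ_apply, h]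
    exact derives_iterate_kappa_or n α β

/-- The iterates of `ρ` reach a weakest one, those of `κ` a strongest one. -/
theorem exists_iterate_bounds (φ : Formula PV) :
    (∃ N, ∀ n, Derives s4 cl Γ (rho^[n] φ) (rho^[N] φ)) ∧
      ∃ N, ∀ n, Derives s4 cl Γ (kappa^[N] φ) (kappa^[n] φ) := by
  have fixed : ∀ {φ : Formula PV}, φ.rho = φ → φ.kappa = φ →
      (∃ N, ∀ n, Derives s4 cl Γ (rho^[n] φ) (rho^[N] φ)) ∧
        ∃ N, ∀ n, Derives s4 cl Γ (kappa^[N] φ) (kappa^[n] φ) := fun hr hk =>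
    ⟨⟨0, fun n => by rw [Function.iterate_fixed hr]; exact .id _⟩,
      ⟨0, fun n => by rw [Function.iterate_fixed hk n]; exact .id _⟩⟩
  induction φ with
  | top | bot | var => exact fixed rfl rfl
  | neg φ ih =>
    obtain ⟨⟨a, ha⟩, b, hb⟩ := ih
    refine ⟨⟨b, fun n => ?_⟩, a, fun n => ?_⟩
    · simpa only [iterate_rho_neg] using neg_anti (hb n)
    · simpa only [iterate_kappa_neg] using neg_anti (ha n)
  | and φ ψ ihφ ihψ =>
    obtain ⟨⟨⟨a, ha⟩, -⟩, ⟨b, hb⟩, -⟩ := And.intro ihφ ihψ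
    exact ⟨⟨a + b, fun n => cut (iterate_rho_and_derives n φ ψ ha hb)
      (derives_iterate_rho_and a b φ ψ)⟩, 1, kappa_derives_iterate_kappa rfl⟩
  | or φ ψ ihφ ihψ =>
    obtain ⟨⟨⟨a, ha⟩, -⟩, ⟨b, hb⟩, -⟩ := And.intro ihφ ihψ
    -- The two components stabilize at different indices; both are moved up to the common index `b +
    -- a`.
    have rise : ∀ (θ : Formula PV) (i j : ℕ),
        Derives s4 cl Γ (rho^[i] θ) (rho^[j + i] θ) := by
      intro θ i j
      induction j with
      | zero => rw [Nat.zero_add]; exact .id _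
      | succ j ih =>
        rw [Nat.succ_add, Function.iterate_succ_apply']
        exact cut ih (derives_rho_and_kappa_derives _).1
    refine ⟨⟨b + a, fun n => iterate_rho_or_derives n φ ψ (fun i _ => ?_) (fun i _ => ?_)⟩, 0,
      fun n => derives_iterate_kappa_or n φ ψ⟩
    · exact cut (cut (ha i) (rise φ a b)) (derives_iterate_rho_or _ _ _).1
    · exact cut (cut (hb i) (Nat.add_comm a b ▸ rise ψ b a)) (derives_iterate_rho_or _ _ _).2
  | imp φ ψ ihφ ihψ =>
    obtain ⟨⟨-, a, ha⟩, ⟨b, hb⟩, -⟩ := And.intro ihφ ihψ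
    exact ⟨⟨a + b, fun n => cut (iterate_rho_imp_derives n φ ψ ha hb)
      (derives_iterate_rho_imp a b φ ψ)⟩, 1, kappa_derives_iterate_kappa rfl⟩
  | box φ ih =>
    obtain ⟨⟨a, ha⟩, b, hb⟩ := ih
    -- The first `ρ` turns `□φ` into `◇φ`, and only then does `ρ` act inside; hence the shift by one
    -- and the separate case `n = 0`. The case of `◇` is dual.
    refine ⟨⟨a + 1, fun n => ?_⟩, b, fun n => ?_⟩
    · rw [Function.iterate_succ_apply, rho, iterate_rho_dia]
      cases n with
      | zero => exact cut (box_T _) (cut (ha 0) (dia_T _))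
      | succ n =>
        rw [Function.iterate_succ_apply, rho, iterate_rho_dia]
        exact dia_mono (ha n)
    · simpa only [iterate_kappa_box] using box_mono (hb n)
  | dia φ ih =>
    obtain ⟨⟨a, ha⟩, b, hb⟩ := ih
    refine ⟨⟨a, fun n => ?_⟩, b + 1, fun n => ?_⟩
    · simpa only [iterate_rho_dia] using dia_mono (ha n)
    · rw [Function.iterate_succ_apply, kappa, iterate_kappa_box]
      cases n with
      | zero => exact cut (box_T _) (cut (hb 0) (dia_T _))
      | succ n =>
        rw [Function.iterate_succ_apply, kappa, iterate_kappa_box]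
        exact box_mono (hb n)

/-- The weakest iterate is entailed by its own `ρ`, and it entails it because `ρ` weakens. -/
theorem exists_synEquiv_rho_iterate (φ : Formula PV) :
    ∃ N, SynEquiv s4 cl (rho (rho^[N] φ)) (rho^[N] φ) := by
  obtain ⟨N, hN⟩ := (exists_iterate_bounds (s4 := s4) (cl := cl) (Γ := ∅) φ).1
  exact ⟨N, Function.iterate_succ_apply' rho N φ ▸ hN (N + 1),
    (derives_rho_and_kappa_derives _).1⟩

end Formula

end Calculus

/-! ### The postulates from an entailment relation -/

section Postulates

variable {PV : Type w} {eqv : Formula PV → Formula PV → Prop} {χ : Formula PV}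

/-- If some iterate of `ρ` is a fixed point of `ρ` up to equivalence, an iterate of `τ` is the
chosen tautology. -/
theorem exists_tau_iterate_eq {φ : Formula PV}
    (h : ∃ N, eqv (Formula.rho (Formula.rho^[N] φ)) (Formula.rho^[N] φ)) :
    ∃ k, (tau eqv χ)^[k] φ = χ := by
  obtain ⟨N, hN⟩ := h
  induction N generalizing φ with
  | zero => exact ⟨1, if_pos hN⟩
  | succ N ih =>
    -- Either `τ` jumps to `χ` at once, or `τ φ = ρ φ` and the fixed point is one step nearer. The
    -- jump may occur before `N`.
    by_cases hφ : eqv φ.rho φ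
    · exact ⟨1, if_pos hφ⟩
    · obtain ⟨k, hk⟩ := ih hN
      refine ⟨k + 1, ?_⟩
      rwa [Function.iterate_succ_apply, tau, if_neg hφ]

/-- Common to both notions: `le` will be derivability in the syntactic case and inclusion of `Mod`
in the semantic one. -/
theorem satisfiesAGM_of_entailment {M : Type*} {Mod : Formula PV → Set M}
    {cons : Formula PV → Prop} {le : Formula PV → Formula PV → Prop}
    (le_trans : ∀ {φ ψ θ}, le φ ψ → le ψ θ → le φ θ)
    (and_left : ∀ φ ψ, le (.and φ ψ) φ) (and_right : ∀ φ ψ, le (.and φ ψ) ψ)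
    (and_intro : ∀ {φ ψ θ}, le φ ψ → le φ θ → le φ (.and ψ θ))
    (le_chi : ∀ φ, le φ χ) (le_refl : ∀ φ, le φ φ)
    (cons_mono : ∀ {φ ψ}, le φ ψ → cons φ → cons ψ)
    (mod_mono : ∀ {φ ψ}, le φ ψ → Mod φ ⊆ Mod ψ)
    (eqv_iff : ∀ φ ψ, eqv φ ψ ↔ le φ ψ ∧ le ψ φ)
    (rho_stable : ∀ φ, ∃ N, eqv (Formula.rho (Formula.rho^[N] φ)) (Formula.rho^[N] φ)) :
    SatisfiesAGM Mod cons eqv (revise cons eqv χ) := by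
  have and_assoc : ∀ φ ψ θ, le (.and (.and φ ψ) θ) (.and φ (.and ψ θ)) := fun φ ψ θ =>
    and_intro (le_trans (and_left _ _) (and_left _ _))
      (and_intro (le_trans (and_left _ _) (and_right _ _)) (and_right _ _))
  have and_assoc' : ∀ φ ψ θ, le (.and φ (.and ψ θ)) (.and (.and φ ψ) θ) := fun φ ψ θ =>
    and_intro (and_intro (and_left _ _) (le_trans (and_right _ _) (and_left _ _)))
      (le_trans (and_right _ _) (and_right _ _))
  have and_right_mono : ∀ φ {ψ ψ'}, le ψ ψ' → le (.and φ ψ) (.and φ ψ') := fun φ _ _ h =>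
    and_intro (and_left _ _) (le_trans (and_right _ _) h)
  refine ⟨?_, fun φ ψ => mod_mono (and_right _ _), ?_, ?_, ?_⟩
  · intro φ ψ hψ
    obtain ⟨k, hk⟩ := exists_tau_iterate_eq (χ := χ) (rho_stable φ)
    -- A nonempty set of naturals contains its infimum; the exponent `k` with `τ^k(φ) = χ` shows
    -- nonemptiness.
    refine Nat.sInf_mem (s := {k | cons (((tau eqv χ)^[k] φ).and ψ)}) ⟨k, ?_⟩
    change cons _
    rw [hk]
    exact cons_mono (and_intro (le_chi ψ) (le_refl ψ)) hψ
  · intro φ ψ h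
    have h0 : revisionIndex cons eqv χ φ ψ = 0 := Nat.sInf_eq_zero.2 (Or.inl h)
    rw [revise, h0]
    rfl
  · intro φ ψ ψ' h
    obtain ⟨h1, h2⟩ := (eqv_iff _ _).1 h
    have hn : revisionIndex cons eqv χ φ ψ = revisionIndex cons eqv χ φ ψ' :=
      congrArg sInf (Set.ext fun k =>
        ⟨cons_mono (and_right_mono _ h1), cons_mono (and_right_mono _ h2)⟩)
    rw [revise, revise, hn]
    exact (mod_mono (and_right_mono _ h1)).antisymm (mod_mono (and_right_mono _ h2))
  · intro φ ψ θ h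
    -- The hypothesis makes the index for `ψ` admissible for `ψ ∧ θ`; conversely an index admissible
    -- for `ψ ∧ θ` is admissible for the weaker `ψ`. So the minima agree and only associativity of
    -- `∧` remains.
    have hn : revisionIndex cons eqv χ φ (ψ.and θ) = revisionIndex cons eqv χ φ ψ := by
      have mem : revisionIndex cons eqv χ φ ψ ∈
          {k | cons (((tau eqv χ)^[k] φ).and (ψ.and θ))} := cons_mono (and_assoc _ _ _) h
      refine le_antisymm (Nat.sInf_le mem) (Nat.sInf_le ?_)
      exact cons_mono (and_right_mono _ (and_left ψ θ)) (Nat.sInf_mem ⟨_, mem⟩)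
    rw [revise, revise, hn]
    exact (mod_mono (and_assoc _ _ _)).antisymm (mod_mono (and_assoc' _ _ _))

end Postulates


-- Substitution, comprehension and quantifiers in the internal logic

noncomputable section Soundness

variable {C : Type u} [Category.{v} C] [CartesianMonoidalCategory C] [MonoidalClosed C]
  [HasFiniteLimits C] [HasSubobjectClassifier C]

theorem subst_mem {Δ Γ X : C} (f : Δ ⟶ Γ) (t : Γ ⟶ X) (s : Γ ⟶ Pow X) :
    subst f (mem t s) = mem (f ≫ t) (f ≫ s) := by
  rw [mem, mem, ← subst_comp, comp_lift]

theorem comp_compr {Δ Γ X : C} (f : Δ ⟶ Γ) (A : Subobject (X ⊗ Γ)) :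
    f ≫ compr A = compr (subst (X ◁ f) A) := by
  rw [compr, compr, ← MonoidalClosed.curry_natural_left, ← char_subst]

/-- The β-rule for comprehension; `compr_mem` is the η-rule. -/
theorem mem_compr {Γ X : C} (t : Γ ⟶ X) (A : Subobject (X ⊗ Γ)) :
    mem t (compr A) = subst (lift t (𝟙 Γ)) A := by
  have e : lift t (compr A) = lift t (𝟙 Γ) ≫ X ◁ compr A := by ext <;> simp
  rw [mem, memRel, subst_holds, e, Category.assoc, compr, ← MonoidalClosed.uncurry_eq,
    MonoidalClosed.uncurry_curry, ← subst_holds, holds_char]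

theorem compr_mem {Γ X : C} (s : Γ ⟶ Pow X) : compr (mem (fst X Γ) (snd X Γ ≫ s)) = s := by
  have e : lift (fst X Γ) (snd X Γ ≫ s) = X ◁ s := by ext <;> simp
  rw [compr, mem, memRel, subst_holds, char_holds, e, ← MonoidalClosed.uncurry_eq,
    MonoidalClosed.curry_uncurry]

theorem compr_injective {Γ X : C} : Function.Injective (compr : Subobject (X ⊗ Γ) → _) := by
  intro A B h
  rw [← holds_char A, ← holds_char B, MonoidalClosed.curry_injective h]

theorem mem_inter {Γ X : C} (t : Γ ⟶ X) (s s' : Γ ⟶ Pow X) :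
    mem t (inter s s') = mem t s ⊓ mem t s' := by
  rw [inter, mem_compr, subst_inf, subst_mem, subst_mem]
  simp

theorem comp_inter {Δ Γ X : C} (f : Δ ⟶ Γ) (s s' : Γ ⟶ Pow X) :
    f ≫ inter s s' = inter (f ≫ s) (f ≫ s') := by
  rw [inter, inter, comp_compr, subst_inf, subst_mem, subst_mem]
  simp

theorem subst_incl {Δ Γ X : C} (f : Δ ⟶ Γ) (s t : Γ ⟶ Pow X) :
    subst f (incl s t) = incl (f ≫ s) (f ≫ t) := by
  apply le_antisymm <;> rw [le_iff] <;> intro T h hh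
  all_goals
    simp only [← subst_comp] at hh ⊢
    rw [← factors_iff, incl, equalizerSubobject_factors_iff] at hh ⊢
    simpa only [comp_inter, Category.assoc] using hh

/-- The formula `s ⪯ t` says that all elements of `s` are elements of `t`. -/
theorem incl_eq_all {Γ X : C} (s t : Γ ⟶ Pow X) :
    incl s t = all X (mem (fst _ _) (snd _ _ ≫ s) ⇨ mem (fst _ _) (snd _ _ ≫ t)) := by
  have key : ∀ {T : C} (s t : T ⟶ Pow X), inter s t = s ↔
      mem (fst X T) (snd X T ≫ s) ≤ mem (fst X T) (snd X T ≫ t) := by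
    intro T s t
    conv_lhs => rhs; rw [← compr_mem s]
    rw [inter, compr_injective.eq_iff, inf_eq_left]
  change _ = all X (impl _ _)
  apply le_antisymm <;> rw [le_iff] <;> intro T g hg
  · rw [← factors_iff, incl, equalizerSubobject_factors_iff, comp_inter, key] at hg
    rw [subst_all_eq_top, subst_impl_eq_top]
    simpa [subst_mem] using hg
  · rw [← factors_iff, incl, equalizerSubobject_factors_iff, comp_inter, key]
    rw [subst_all_eq_top, subst_impl_eq_top] at hg
    simpa [subst_mem] using hg

theorem subst_himp {Δ Γ : C} (g : Δ ⟶ Γ) (A B : Subobject Γ) :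
    subst g (A ⇨ B) = subst g A ⇨ subst g B := subst_impl g A B

theorem subst_omegaVar_whiskerLeft {Δ Γ : C} (g : Δ ⟶ Γ) :
    subst (_ ◁ g) (omegaVar Γ) = omegaVar Δ := by
  rw [omegaVar, omegaVar, subst_holds, whiskerLeft_fst]

theorem subst_bot {Δ Γ : C} (g : Δ ⟶ Γ) : subst g (⊥ : Subobject Γ) = ⊥ := by
  change subst g (fals Γ) = fals Δ
  rw [fals, fals, subst_all, subst_omegaVar_whiskerLeft]

/-- Beck–Chevalley for `∃`, inherited from the stability of `∀` and `⇒` through the second-order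
encoding. -/
theorem subst_ex {Δ Γ : C} (X : C) (g : Δ ⟶ Γ) (A : Subobject (X ⊗ Γ)) :
    subst g (ex X A) = ex X (subst (X ◁ g) A) := by
  simp only [ex, subst_all, subst_impl, ← subst_comp, ← whiskerLeft_comp, whiskerLeft_snd,
    subst_omegaVar_whiskerLeft]
  rw [subst_comp (snd _ _) (_ ◁ g), subst_omegaVar_whiskerLeft]

theorem all_mono {Γ : C} (X : C) {A B : Subobject (X ⊗ Γ)} (h : A ≤ B) : all X A ≤ all X B :=
  (le_all_iff _ _ _).2 (((le_all_iff _ _ _).1 le_rfl).trans h)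

theorem ex_mono {Γ : C} (X : C) {A B : Subobject (X ⊗ Γ)} (h : A ≤ B) : ex X A ≤ ex X B :=
  (ex_le_iff _ _ _).2 (h.trans ((ex_le_iff _ _ _).1 le_rfl))

theorem subst_le_ex {Γ X : C} (t : Γ ⟶ X) (A : Subobject (X ⊗ Γ)) :
    subst (lift t (𝟙 Γ)) A ≤ ex X A := by
  have h := subst_mono (lift t (𝟙 Γ)) ((ex_le_iff X A _).1 le_rfl)
  rwa [← subst_comp, lift_snd, subst_id] at h

/-- Frobenius reciprocity, a consequence of substitution preserving implication. -/
theorem inf_ex_le_iff {Γ : C} (X : C) (U D : Subobject Γ) (A : Subobject (X ⊗ Γ)) :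
    U ⊓ ex X A ≤ D ↔ subst (snd X Γ) U ⊓ A ≤ subst (snd X Γ) D := by
  rw [inf_comm, ← le_himp_iff, ex_le_iff, subst_himp, le_himp_iff, inf_comm]

theorem ex_bot {Γ : C} (X : C) : ex X (⊥ : Subobject (X ⊗ Γ)) = ⊥ :=
  le_bot_iff.1 ((ex_le_iff _ _ _).2 bot_le)

theorem all_eq_top_iff {Γ X : C} {A : Subobject (X ⊗ Γ)} : all X A = ⊤ ↔ A = ⊤ := by
  rw [← top_le_iff, le_all_iff, subst_top, top_le_iff]

/-- Instantiation of a valid universally quantified implication. -/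
theorem le_of_all_eq_top {Γ Δ X : C} {A B : Subobject (X ⊗ Γ)} (h : all X (A ⇨ B) = ⊤)
    (t : Δ ⟶ X) (g : Δ ⟶ Γ) : subst (lift t g) A ≤ subst (lift t g) B := by
  rw [all_eq_top_iff, himp_eq_top_iff] at h
  exact subst_mono _ h

/-- The constant term of type `PX` given by a subobject of `X`. -/
def name (Γ : C) {X : C} (A : Subobject X) : Γ ⟶ Pow X := compr (subst (fst X Γ) A)

theorem comp_name {Δ Γ X : C} (f : Δ ⟶ Γ) (A : Subobject X) : f ≫ name Γ A = name Δ A := by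
  rw [name, comp_compr, ← subst_comp, whiskerLeft_fst, name]

theorem toUnit_toGlobal {Γ X : C} (A : Subobject X) : toUnit Γ ≫ toGlobal A = name Γ A :=
  comp_name _ A

theorem mem_name {Γ X : C} (t : Γ ⟶ X) (A : Subobject X) : mem t (name Γ A) = subst t A := by
  rw [name, mem_compr, ← subst_comp, lift_fst]

theorem inter_name {Γ X : C} (A B : Subobject X) :
    inter (name Γ A) (name Γ B) = name Γ (A ⊓ B) := by
  simp only [inter, comp_name, mem_name]
  rw [← subst_inf, name]

theorem onSub_eq {X : C} (f : Pow X ⟶ Pow X) (A : Subobject X) :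
    onSub f A = mem (𝟙 X) (name X A ≫ f) := by
  rw [onSub, ofGlobal, ← toUnit_toGlobal, Category.assoc]

-- The modal operators on subobjects and their laws

variable {X : C} {N : X ⟶ Pow (Pow X)}

/-- The operation on subobjects interpreting `□`. -/
def boxSub (N : X ⟶ Pow (Pow X)) (A : Subobject X) : Subobject X := mem (name X A) N

/-- The formula `∃ y, y ∈ s ∧ A`. -/
def meets {Γ : C} (s : Γ ⟶ Pow X) (A : Subobject X) : Subobject Γ :=
  ex X (mem (fst X Γ) (snd X Γ ≫ s) ⊓ subst (fst X Γ) A)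

/-- The operation on subobjects interpreting `◇`. -/
def diaSub (N : X ⟶ Pow (Pow X)) (A : Subobject X) : Subobject X :=
  all (Pow X) (mem (fst _ _) (snd _ _ ≫ N) ⇨ meets (fst (Pow X) X) A)

theorem onSub_erosion (N : X ⟶ Pow (Pow X)) (A : Subobject X) :
    onSub (erosion N) A = boxSub N A := by
  rw [onSub_eq, erosion, comp_compr, mem_compr, ← subst_comp, subst_mem, boxSub]
  simp

theorem onSub_dilation (N : X ⟶ Pow (Pow X)) (A : Subobject X) :
    onSub (dilation N) A = diaSub N A := by
  rw [onSub_eq, dilation, comp_compr, mem_compr, ← subst_comp, subst_all, subst_himp, subst_ex,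
    subst_mem, subst_mem]
  simp only [comp_inter, mem_inter, diaSub, meets]
  rw [← mem_name (fst X (Pow X ⊗ X)) A]
  simp [comp_name]

theorem subst_boxSub {Γ : C} (x : Γ ⟶ X) (A : Subobject X) :
    subst x (boxSub N A) = mem (name Γ A) (x ≫ N) := by
  rw [boxSub, subst_mem, comp_name]

theorem subst_meets {Δ Γ : C} (f : Δ ⟶ Γ) (s : Γ ⟶ Pow X) (A : Subobject X) :
    subst f (meets s A) = meets (f ≫ s) A := by
  rw [meets, subst_ex, subst_inf, subst_mem, ← subst_comp]
  simp [meets]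

theorem meets_mono {Γ : C} (s : Γ ⟶ Pow X) {A B : Subobject X} (h : A ≤ B) :
    meets s A ≤ meets s B := ex_mono X (inf_le_inf_left _ (subst_mono _ h))

theorem meets_name {Γ : C} (A B : Subobject X) :
    meets (name Γ A) B = ex X (subst (fst X Γ) (A ⊓ B)) := by
  rw [meets, comp_name, mem_name, subst_inf]

/-- Elimination of the witness: a common point of `s` and `A` also satisfies `Q`, which holds
throughout `s`. -/
theorem meets_inf_all_le {Γ : C} (s : Γ ⟶ Pow X) (A : Subobject X) {D : Subobject Γ}
    {Q : Subobject (X ⊗ Γ)} (h : subst (fst X Γ) A ⊓ Q ≤ subst (snd X Γ) D) :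
    meets s A ⊓ all X (mem (fst X Γ) (snd X Γ ≫ s) ⇨ Q) ≤ D := by
  rw [inf_comm, meets, inf_ex_le_iff]
  refine le_trans (le_inf (inf_le_right.trans inf_le_right) ?_) h
  exact (inf_le_inf ((le_all_iff _ _ _).1 le_rfl) inf_le_left).trans himp_inf_le

/-- A point of `◇A` has all its neighborhoods meeting `A`. -/
theorem subst_diaSub_inf_mem_le {Γ : C} (x : Γ ⟶ X) (s : Γ ⟶ Pow X) (A : Subobject X) :
    subst x (diaSub N A) ⊓ mem s (x ≫ N) ≤ meets s A := by
  rw [diaSub, subst_all]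
  refine (inf_le_inf_right _ (all_le_subst s _)).trans ?_
  rw [subst_himp, subst_himp, ← subst_comp, ← subst_comp, subst_mem, subst_meets]
  simp

theorem le_diaSub_iff {U A : Subobject X} : U ≤ diaSub N A ↔
    subst (snd (Pow X) X) U ⊓ mem (fst _ _) (snd _ _ ≫ N) ≤ meets (fst _ _) A := by
  rw [diaSub, le_all_iff, le_himp_iff]

namespace IsStructuringNeighborhood

section Terms

variable {Γ : C} (hN : IsStructuringNeighborhood N) (x : Γ ⟶ X)
include hN

theorem mem_inf_mem_le (s t : Γ ⟶ Pow X) :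
    mem s (x ≫ N) ⊓ mem t (x ≫ N) ≤ mem (inter s t) (x ≫ N) := by
  have h := hN.filter
  simp only [filterFormula, inf_eq_top_iff] at h
  simpa [subst_inf, subst_mem, comp_inter] using
    le_of_all_eq_top (all_eq_top_iff.1 h.1.1.1) t (lift s x)

theorem mem_inf_incl_le (s t : Γ ⟶ Pow X) :
    mem s (x ≫ N) ⊓ incl s t ≤ mem t (x ≫ N) := by
  have h := hN.filter
  simp only [filterFormula, inf_eq_top_iff] at h
  simpa [subst_inf, subst_mem, subst_incl] using
    le_of_all_eq_top (all_eq_top_iff.1 h.1.1.2) t (lift s x)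

theorem mem_le_mem (s : Γ ⟶ Pow X) : mem s (x ≫ N) ≤ mem x s := by
  simpa [subst_mem] using le_of_all_eq_top hN.point s x

end Terms

variable (hN : IsStructuringNeighborhood N)
include hN

theorem boxSub_top : boxSub N ⊤ = ⊤ := by
  have h := hN.filter
  simp only [filterFormula, inf_eq_top_iff] at h
  rw [boxSub, name, subst_top]
  exact h.1.2

theorem boxSub_mono {A B : Subobject X} (h : A ≤ B) : boxSub N A ≤ boxSub N B := by
  have h1 : incl (name X A) (name X B) = ⊤ := by
    rw [incl_eq_all, all_eq_top_iff, himp_eq_top_iff]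
    simpa only [comp_name, mem_name] using subst_mono _ h
  have h2 := hN.mem_inf_incl_le (𝟙 X) (name X A) (name X B)
  rwa [h1, inf_top_eq, Category.id_comp] at h2

theorem boxSub_inf (A B : Subobject X) : boxSub N (A ⊓ B) = boxSub N A ⊓ boxSub N B := by
  refine le_antisymm (le_inf (hN.boxSub_mono inf_le_left) (hN.boxSub_mono inf_le_right)) ?_
  have h := hN.mem_inf_mem_le (𝟙 X) (name X A) (name X B)
  rwa [inter_name, Category.id_comp] at h

theorem boxSub_le (A : Subobject X) : boxSub N A ≤ A := by
  have h := hN.mem_le_mem (𝟙 X) (name X A)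
  rwa [mem_name, subst_id, Category.id_comp] at h

theorem boxSub_himp_le (A B : Subobject X) :
    boxSub N (A ⇨ B) ≤ boxSub N A ⇨ boxSub N B := by
  rw [le_himp_iff, ← hN.boxSub_inf]
  exact hN.boxSub_mono himp_inf_le

theorem le_diaSub (A : Subobject X) : A ≤ diaSub N A := by
  rw [le_diaSub_iff]
  -- The witness is the point itself, which lies in each of its neighborhoods.
  refine le_trans ?_ (subst_le_ex (snd (Pow X) X) _)
  rw [subst_inf, subst_mem, ← subst_comp, lift_fst, lift_snd_assoc, Category.id_comp, inf_comm]
  exact inf_le_inf_right _ (hN.mem_le_mem _ _)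

omit hN in
theorem diaSub_mono {A B : Subobject X} (h : A ≤ B) : diaSub N A ≤ diaSub N B :=
  all_mono _ (himp_le_himp_left (meets_mono _ h))

omit hN in
-- `B` is one of the neighborhoods that must meet `A`. With `B = ⊤` this gives `◇⊥ = ⊥`, with `B =
-- ¬A` the duality axiom.
theorem diaSub_inf_boxSub_le (A B : Subobject X) :
    diaSub N A ⊓ boxSub N B ≤ ex X (subst (fst X X) (B ⊓ A)) := by
  have h := subst_diaSub_inf_mem_le (N := N) (𝟙 X) (name X B) A
  rwa [subst_id, Category.id_comp, meets_name] at h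

theorem diaSub_bot : diaSub N ⊥ = ⊥ := by
  have h := diaSub_inf_boxSub_le (N := N) ⊥ ⊤
  rwa [hN.boxSub_top, inf_top_eq, inf_bot_eq, subst_bot, ex_bot, le_bot_iff] at h

omit hN in
theorem boxSub_himp_bot_le (A : Subobject X) : boxSub N (A ⇨ ⊥) ≤ diaSub N A ⇨ ⊥ := by
  rw [le_himp_iff, inf_comm]
  refine (diaSub_inf_boxSub_le _ _).trans ?_
  rw [le_bot_iff.1 (himp_inf_le (a := A) (b := ⊥)), subst_bot, ex_bot]

end IsStructuringNeighborhood

-- The S4 laws for topological neighborhoods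

namespace IsTopologicalNeighborhood

variable (hN : IsTopologicalNeighborhood N)
include hN

theorem mem_le_ex {Γ : C} (x : Γ ⟶ X) (s : Γ ⟶ Pow X) :
    mem s (x ≫ N) ≤ ex (Pow X) (mem (fst _ _) (snd _ _ ≫ x ≫ N) ⊓
      all X (mem (fst _ _) (snd _ _ ≫ fst _ _) ⇨
        mem (snd _ _ ≫ snd _ _ ≫ s) (fst X (Pow X ⊗ Γ) ≫ N))) := by
  simpa [subst_mem, subst_ex, subst_inf, subst_all, subst_himp] using
    le_of_all_eq_top hN.topological s x

/-- The neighborhood `B` provided by the topological axiom is contained in `{y | A ∈ N(y)} = □A`,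
and filters are upward closed. -/
theorem boxSub_le_boxSub_boxSub (A : Subobject X) : boxSub N A ≤ boxSub N (boxSub N A) := by
  have h := hN.mem_le_ex (𝟙 X) (name X A)
  rw [Category.id_comp] at h
  refine h.trans ((ex_le_iff _ _ _).2 ?_)
  have h1 := hN.mem_inf_incl_le (snd (Pow X) X) (fst _ _) (name _ (boxSub N A))
  rw [incl_eq_all] at h1
  rw [subst_boxSub]
  simpa only [comp_name, mem_name, subst_boxSub] using h1

/-- Given `S ∈ N(x)`, choose `B ∈ N(x)` with `S ∈ N(y)` for all `y ∈ B`. At a point `x` of `◇◇A`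
this `B` meets `◇A` at some `y`, and then `S`, a neighborhood of `y`, meets `A`. -/
theorem diaSub_diaSub_le (A : Subobject X) : diaSub N (diaSub N A) ≤ diaSub N A := by
  rw [le_diaSub_iff]
  refine (inf_le_inf_left _ (hN.mem_le_ex _ _)).trans ?_
  rw [inf_ex_le_iff, ← subst_comp, ← inf_assoc]
  have h := subst_diaSub_inf_mem_le (N := N) (snd (Pow X) (Pow X ⊗ X) ≫ snd (Pow X) X)
    (fst _ _) (diaSub N A)
  rw [Category.assoc] at h
  refine (inf_le_inf_right _ h).trans ?_
  refine meets_inf_all_le _ _ ?_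
  have h' := subst_diaSub_inf_mem_le (N := N) (fst X (Pow X ⊗ (Pow X ⊗ X)))
    (snd _ _ ≫ snd _ _ ≫ fst _ _) A
  rwa [subst_meets, subst_meets]

end IsTopologicalNeighborhood

-- Soundness and its consequences for classes of models

namespace Model

variable {PV : Type w} {s4 : Prop}

/-- Soundness of the sequent calculus. -/
theorem sem_le_of_derives (M : Model C PV s4) {φ ψ : Formula PV}
    (d : Derives s4 (IsBoolean C) ∅ φ ψ) : M.sem φ ≤ M.sem ψ := by
  have hN := M.structuring
  induction d with
  | hyp h => exact absurd h (Set.notMem_empty _)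
  | id => exact le_rfl
  | cut _ _ h h' => exact h.trans h'
  | box_top =>
    simp only [sem, onSub_erosion, hN.boxSub_top, le_refl]
  | dia_bot => simp only [sem, onSub_dilation, hN.diaSub_bot, le_refl]
  | duality φ =>
    simp only [sem, onSub_dilation, onSub_erosion]
    exact IsStructuringNeighborhood.boxSub_himp_bot_le _
  | box_and φ ψ | and_box φ ψ => simp only [sem, onSub_erosion, hN.boxSub_inf, le_refl]
  | or_dia φ ψ =>
    simp only [sem, onSub_dilation]
    exact sup_le (IsStructuringNeighborhood.diaSub_mono le_sup_left)
      (IsStructuringNeighborhood.diaSub_mono le_sup_right)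
  | axK φ ψ =>
    simp only [sem, onSub_erosion]
    exact hN.boxSub_himp_le _ _
  | box_T φ =>
    simp only [sem, onSub_erosion]
    exact hN.boxSub_le _
  | dia_T φ =>
    simp only [sem, onSub_dilation]
    exact hN.le_diaSub _
  | box_S4 φ h =>
    simp only [sem, onSub_erosion]
    exact (M.topological h).boxSub_le_boxSub_boxSub _
  | dia_S4 φ h =>
    simp only [sem, onSub_dilation]
    exact (M.topological h).diaSub_diaSub_le _
  | classical φ h =>
    have hA := h M.X (M.sem φ)
    change (M.sem φ ⇨ ⊥) ⇨ ⊥ ≤ M.sem φ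
    -- Meeting `¬¬A` with `A ∨ ¬A = ⊤` leaves a part below `A` and the part `¬¬A ∧ ¬A`, which is
    -- `⊥`.
    rw [← inf_top_eq ((M.sem φ ⇨ ⊥) ⇨ ⊥), ← hA, inf_sup_left, himp_inf_self]
    exact sup_le inf_le_right (inf_le_left.trans bot_le)
  | bot_left => exact bot_le
  | top_right => exact le_top
  | and_left => exact inf_le_left
  | and_right => exact inf_le_right
  | and_idem => exact le_inf le_rfl le_rfl
  | and_comm => exact (_root_.inf_comm _ _).le
  | and_intro _ _ h h' => exact le_inf h h'
  | or_left => exact le_sup_left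
  | or_right => exact le_sup_right
  | or_comm => exact (_root_.sup_comm _ _).le
  | or_elim _ _ h h' => exact sup_le h h'
  | or_inv_left _ h => exact le_sup_left.trans h
  | or_inv_right _ h => exact le_sup_right.trans h
  | distrib => exact inf_sup_left _ _ _ |>.le
  | distrib_inv => exact inf_sup_left _ _ _ |>.ge
  | imp_intro _ h => exact le_himp_iff.2 h
  | imp_elim _ h => exact le_himp_iff.1 h
  | neg_imp | imp_neg => exact le_rfl
  | box_mono _ h =>
    simp only [sem, onSub_erosion]
    exact hN.boxSub_mono h
  | dia_mono _ h =>
    simp only [sem, onSub_dilation]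
    exact IsStructuringNeighborhood.diaSub_mono h

end Model

theorem mod_subset_of_derives {PV : Type w} {s4 : Prop} {φ ψ : Formula PV}
    (d : Derives s4 (IsBoolean C) ∅ φ ψ) : Mod C s4 φ ⊆ Mod C s4 ψ :=
  fun M (hM : M.sem φ = ⊤) => top_le_iff.1 (hM.ge.trans (M.sem_le_of_derives d))

theorem mod_and {PV : Type w} {s4 : Prop} (φ ψ : Formula PV) :
    Mod C s4 (φ.and ψ) = Mod C s4 φ ∩ Mod C s4 ψ :=
  Set.ext fun _ => inf_eq_top_iff

theorem semEquiv_of_synEquiv {PV : Type w} {s4 : Prop} {φ ψ : Formula PV}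
    (h : SynEquiv s4 (IsBoolean C) φ ψ) : SemEquiv C s4 φ ψ :=
  (mod_subset_of_derives h.1).antisymm (mod_subset_of_derives h.2)

end Soundness

end MorphoLogic

theorem proposition15 {C : Type u} [Category.{v} C] [CartesianMonoidalCategory C]
    [MonoidalClosed C] [HasFiniteLimits C] [HasSubobjectClassifier C]
    (hC : IsEmpty (IsInitial (𝟙_ C))) {PV : Type w} [Countable PV] (s4 : Prop)
    (χ : MorphoLogic.Formula PV) :
    (MorphoLogic.SynEquiv s4 (MorphoLogic.IsBoolean C) χ .top →
      MorphoLogic.SatisfiesAGM (MorphoLogic.Mod C s4)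
        (MorphoLogic.SynConsistent s4 (MorphoLogic.IsBoolean C))
        (MorphoLogic.SynEquiv s4 (MorphoLogic.IsBoolean C))
        (MorphoLogic.revise (MorphoLogic.SynConsistent s4 (MorphoLogic.IsBoolean C))
          (MorphoLogic.SynEquiv s4 (MorphoLogic.IsBoolean C)) χ)) ∧
    (MorphoLogic.SemEquiv C s4 χ .top →
      MorphoLogic.SatisfiesAGM (MorphoLogic.Mod C s4)
        (MorphoLogic.SemConsistent C s4)
        (MorphoLogic.SemEquiv C s4)
        (MorphoLogic.revise (MorphoLogic.SemConsistent C s4)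
          (MorphoLogic.SemEquiv C s4) χ)) := by
  open MorphoLogic in
  constructor
  · intro hχ
    exact satisfiesAGM_of_entailment (le := Derives s4 (IsBoolean C) ∅)
      .cut .and_left .and_right .and_intro (fun _ => .cut (.top_right _) hχ.2) .id
      SynConsistent.mono mod_subset_of_derives (fun _ _ => Iff.rfl)
      Formula.exists_synEquiv_rho_iterate
  · intro hχ
    -- Entailment is inclusion of model classes rather than the order of each `Sub(X)`, so that
    -- mutual entailment is exactly `SemEquiv`.
    refine satisfiesAGM_of_entailment (le := fun φ ψ => Mod C s4 φ ⊆ Mod C s4 ψ)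
      Set.Subset.trans (fun φ ψ => (mod_and φ ψ).subset.trans Set.inter_subset_left)
      (fun φ ψ => (mod_and φ ψ).subset.trans Set.inter_subset_right)
      (fun h h' => (Set.subset_inter h h').trans (mod_and _ _).superset)
      (fun φ => ?_) (fun _ => subset_rfl)
      (fun h ⟨M, hM, hM'⟩ => ⟨M, h hM, hM'⟩) _root_.id (fun _ _ => Set.Subset.antisymm_iff)
      (fun φ => ?_)
    · exact (mod_subset_of_derives (.top_right φ)).trans hχ.superset
    · obtain ⟨n, hn⟩ := Formula.exists_synEquiv_rho_iterate (s4 := s4) (cl := IsBoolean C) φ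
      exact ⟨n, semEquiv_of_synEquiv hn⟩
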